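/- All hypergraphs are finite and identified with their edge sets. A family $\mathcal F\subseteq 2^{[n]}$ is $e$-union-free if $\bigcup_{A\in\mathcal A}A\neq\bigcup_{B\in\mathcal B}B$ for any two distinct subfamilies $\mathcal A,\mathcal B\subseteq\mathcal F$ with $0<|\mathcal A|,|\mathcal B|\le e$. Let $U_r(n,e)$ be the maximum size of an $e$-union-free family of $r$-element subsets of $[n]$. A perfect matching is a family of edges covering every vertex exactly once. A family is linear if any two distinct members share at most one element. A triangle is a triple of sets $C_1,C_2,C_3$ with $|C_1\cap C_2|=|C_2\cap C_3|=|C_3\cap C_1|=1$ and $C_1\cap C_2\ne C_1\cap C_3$. An $r\times r$ grid consists of two disjoint families $\mathcal A,\mathcal B$ of $r$ sets each, the members of $\mathcal A$ being pairwise disjoint, the members of $\mathcal B$ being pairwise disjoint, and $|A\cap B|=1$ for all $A\in\mathcal A$, $B\in\mathcal B$. For every integer $r\ge 4$ there exists a real number $\beta_r>0$ such that the following holds for all integers $n\ge r$. (i) $n^2 e^{-\beta_r\sqrt{\log n}}<U_r(n,r)$. (ii) If $n=r$ or $n\ge (r-1)^2$, then $U_r(n,r)\le \dfrac{n(n-1)}{r(r-1)}$.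 (iii) If $r$ divides $n$, then there is an $r$-uniform $r$-union-free family $\mathcal F$ on $[n]$ with $|\mathcal F|>n^2e^{-\beta_r\sqrt{\log n}}$ that can be decomposed into pairwise disjoint perfect matchings; in particular $\mathcal F$ is regular, i.e. all vertices lie in the same number of members of $\mathcal F$. Moreover, for every $r\ge 4$, every linear $r$-uniform hypergraph that contains neither a triangle nor an $r\times r$ grid is $r$-union-free. -/

import Mathlib

/-! Hypergraphs are given by their finite edge set `F : Finset (Finset α)` on a finite
vertex set `α`; `r`-uniformity is Mathlib's `Set.Sized r`. -/

/-- Any two distinct edges share at most one vertex. -/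
def IsLinearFamily {α : Type*} [DecidableEq α] (F : Finset (Finset α)) : Prop :=
  ∀ A ∈ F, ∀ B ∈ F, A ≠ B → (A ∩ B).card ≤ 1

/-- Three edges that pairwise meet in three distinct singletons
(the inequality below forces all three singletons to be distinct). -/
def ContainsTriangle {α : Type*} [DecidableEq α] (F : Finset (Finset α)) : Prop :=
  ∃ C₁ ∈ F, ∃ C₂ ∈ F, ∃ C₃ ∈ F,
    (C₁ ∩ C₂).card = 1 ∧ (C₂ ∩ C₃).card = 1 ∧ (C₃ ∩ C₁).card = 1 ∧ C₁ ∩ C₂ ≠ C₁ ∩ C₃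

/-- `F` contains an `a × b` grid: two disjoint subfamilies of `a` and `b` edges, each
consisting of pairwise disjoint edges, such that edges of different subfamilies meet in
exactly one vertex. -/
def ContainsGrid {α : Type*} [DecidableEq α] (a b : ℕ) (F : Finset (Finset α)) : Prop :=
  ∃ 𝒜 ⊆ F, ∃ ℬ ⊆ F, Disjoint 𝒜 ℬ ∧ 𝒜.card = a ∧ ℬ.card = b ∧
    (∀ A ∈ 𝒜, ∀ A' ∈ 𝒜, A ≠ A' → Disjoint A A') ∧
    (∀ B ∈ ℬ, ∀ B' ∈ ℬ, B ≠ B' → Disjoint B B') ∧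
    (∀ A ∈ 𝒜, ∀ B ∈ ℬ, (A ∩ B).card = 1)

/-- Distinct nonempty subfamilies with at most `e` members have distinct unions. -/
def IsUnionFree {α : Type*} [DecidableEq α] (e : ℕ) (F : Finset (Finset α)) : Prop :=
  ∀ 𝒜 ⊆ F, ∀ ℬ ⊆ F, 𝒜 ≠ ℬ → 0 < 𝒜.card → 𝒜.card ≤ e → 0 < ℬ.card → ℬ.card ≤ e →
    𝒜.biUnion id ≠ ℬ.biUnion id

open Classical in
/-- `U_r(n, e)`: the maximum size of an `e`-union-free `r`-uniform family on `n` vertices. -/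
noncomputable def maxUnionFree (r n e : ℕ) : ℕ :=
  ((Finset.univ : Finset (Finset (Finset (Fin n)))).filter
    fun F : Finset (Finset (Fin n)) => (F : Set (Finset (Fin n))).Sized r ∧ IsUnionFree e F).sup Finset.card

/-- The members of `M` cover every vertex exactly once. -/
def IsPerfectMatchingFamily {α : Type*} (M : Finset (Finset α)) : Prop :=
  ∀ x : α, ∃! A, A ∈ M ∧ x ∈ A

/-- `F` is the union of pairwise disjoint subfamilies, each of them a perfect matching. -/
def DecomposesIntoPerfectMatchings {α : Type*} [DecidableEq α] (F : Finset (Finset α)) :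
    Prop :=
  ∃ P : Finset (Finset (Finset α)),
    (∀ M ∈ P, IsPerfectMatchingFamily M) ∧
    (∀ M ∈ P, ∀ M' ∈ P, M ≠ M' → Disjoint M M') ∧
    P.biUnion id = F

/-- All vertices lie in the same number of edges. -/
def IsRegularFamily {α : Type*} [DecidableEq α] (F : Finset (Finset α)) : Prop :=
  ∃ d : ℕ, ∀ x : α, (F.filter fun A => x ∈ A).card = d

/-! Upper bound. In an `r`-union-free family no edge is covered by fewer than `r` other edges, since
adding it to the cover would not change the union. So an edge without a private vertex meets every
other edge at most once. Choosing one private vertex for each edge that has one, the remaining edges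
form a partial Steiner system on the unchosen vertices, and counting pairs gives the bound
(`IsUnionFree.card_mul_le`).

Moreover part. In a linear triangle-free family an edge covered by at most `r` others is met once by
each of exactly `r` pairwise disjoint edges. Two subfamilies with equal unions cover each other in
this way and form a grid.

Construction. Vertices are points `(i, v)` of `Fin r × ZMod m` with `m = n / r`; edges are the lines
`v = x + i² d` with slope `d` in a set `D` of small numbers. Smallness of `D` lets the relevant
equations mod `m` be read in the integers. A triangle would make one slope a weighted average of two
others, which a Behrend-type `D` of size `m * exp(-O(√(log m)))` forbids. A grid would become an
arrangement of real lines in two colours whose bichromatic crossings all lie over `t = i²`;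
following its upper envelope determines enough crossings to contradict the spacing of the squares
(`IsLineGrid.false`). Each slope class is a perfect matching when `r ∣ n`. -/

/-! ### Cover-free families and the upper bound -/

section UpperBound

variable {α : Type*} [DecidableEq α]

/-- In an `r`-union-free family no edge is covered by fewer than `r` other edges. -/
lemma IsUnionFree.not_subset_biUnion {r : ℕ} {F : Finset (Finset α)} (h : IsUnionFree r F)
    {A : Finset α} (hA : A ∈ F) {G : Finset (Finset α)} (hG : G ⊆ F) (hAG : A ∉ G)
    (h0 : 0 < G.card) (hr : G.card < r) : ¬ A ⊆ G.biUnion id := by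
  intro hsub
  refine h (insert A G) (Finset.insert_subset hA hG) G hG ?_ (by simp) ?_ h0 hr.le ?_
  · intro he
    exact hAG (he ▸ Finset.mem_insert_self A G)
  · rw [Finset.card_insert_of_notMem hAG]; omega
  · rw [Finset.biUnion_insert]
    exact Finset.union_eq_right.mpr hsub

/-- An edge of an `r`-union-free `r`-uniform family without a vertex of its own meets every
other edge in at most one vertex. -/
lemma IsUnionFree.card_inter_le_one {r : ℕ} {F : Finset (Finset α)} (h : IsUnionFree r F)
    (hs : (F : Set (Finset α)).Sized r) {A B : Finset α} (hA : A ∈ F) (hB : B ∈ F)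
    (hAB : B ≠ A) (hown : ∀ x ∈ A, ∃ C ∈ F, x ∈ C ∧ C ≠ A) : (A ∩ B).card ≤ 1 := by
  by_contra! hcard
  choose! f hf using hown
  have hcA : A.card = r := hs hA
  have hsd : (A \ B).card + (A ∩ B).card = A.card := Finset.card_sdiff_add_card_inter A B
  have himg : ((A \ B).image f).card ≤ (A \ B).card := Finset.card_image_le
  have hins := Finset.card_insert_le B ((A \ B).image f)
  -- `B` covers at least two points of `A`, and one further edge for each of the at most `r - 2`
  -- others completes a cover by at most `r - 1` edges.
  refine h.not_subset_biUnion hA (G := insert B ((A \ B).image f)) ?_ ?_ (by simp) (by omega) ?_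
  · intro C hC
    rcases Finset.mem_insert.mp hC with rfl | hC
    · exact hB
    · obtain ⟨x, hx, rfl⟩ := Finset.mem_image.mp hC
      exact (hf x (Finset.mem_sdiff.mp hx).1).1
  · intro hC
    rcases Finset.mem_insert.mp hC with hC | hC
    · exact hAB hC.symm
    · obtain ⟨x, hx, he⟩ := Finset.mem_image.mp hC
      exact (hf x (Finset.mem_sdiff.mp hx).1).2.2 he
  · intro x hx
    by_cases hxB : x ∈ B
    · exact Finset.mem_biUnion.mpr ⟨B, Finset.mem_insert_self _ _, hxB⟩
    · exact Finset.mem_biUnion.mpr ⟨f x, Finset.mem_insert_of_mem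
        (Finset.mem_image_of_mem f (Finset.mem_sdiff.mpr ⟨hx, hxB⟩)), (hf x hx).2.1⟩

/-- Sets of size `r` in `V` that pairwise share at most one element contain distinct pairs. -/
lemma card_mul_choose_two_le {r : ℕ} {G : Finset (Finset α)} {V : Finset α}
    (hs : ∀ A ∈ G, A.card = r) (hV : ∀ A ∈ G, A ⊆ V)
    (hlin : ∀ A ∈ G, ∀ B ∈ G, B ≠ A → (A ∩ B).card ≤ 1) :
    G.card * r.choose 2 ≤ V.card.choose 2 := by
  have hdisj : (G : Set (Finset α)).PairwiseDisjoint (fun A => A.powersetCard 2) := by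
    intro A hA B hB hAB
    refine Finset.disjoint_left.mpr fun P hPA hPB => ?_
    rw [Finset.mem_powersetCard] at hPA hPB
    have := Finset.card_le_card (Finset.subset_inter hPA.1 hPB.1)
    have := hlin A hA B hB hAB.symm
    omega
  calc G.card * r.choose 2 = ∑ A ∈ G, (A.powersetCard 2).card := by
        rw [Finset.sum_congr rfl fun A hA => by rw [Finset.card_powersetCard, hs A hA]]
        simp
    _ = (G.biUnion fun A => A.powersetCard 2).card := (Finset.card_biUnion hdisj).symm
    _ ≤ (V.powersetCard 2).card := Finset.card_le_card <| Finset.biUnion_subset.mpr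
        fun A hA => Finset.powersetCard_mono (hV A hA)
    _ = V.card.choose 2 := Finset.card_powersetCard 2 V

lemma two_mul_choose_two_cast (k : ℕ) : (2 : ℤ) * (k.choose 2 : ℤ) = k * (k - 1) := by
  cases k with
  | zero => simp
  | succ k =>
    have h2 : (k + 1) * k / 2 * 2 = (k + 1) * k :=
      Nat.div_mul_cancel (by rw [mul_comm]; exact (Nat.even_mul_succ_self k).two_dvd)
    rw [Nat.choose_two_right]
    zify at h2
    push_cast [Nat.add_sub_cancel] at h2 ⊢
    linarith

/-- Here `g` edges have a chosen private vertex, `l` do not, and `k` vertices are unchosen. Since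
`n(n-1) - k(k-1) = g(n+k-1)`, it suffices that `r(r-1) ≤ n+k-1`, which for `k ≥ r` is exactly what
`(r-1)² ≤ n` provides. For `k = r-1` pair counting forces `l = 0`, and the claim becomes
`(n-r)(n-(r-1)²) ≥ 0`. -/
lemma count_bound {n k g l f r : ℤ} (hr : 2 ≤ r) (hrn : r ≤ n) (hn : n = r ∨ (r - 1) ^ 2 ≤ n)
    (hV : r ≤ k + 1) (hkg : k + g = n) (hgl : g + l = f) (hg : 0 ≤ g) (hl : 0 ≤ l)
    (hpairs : l * (r * (r - 1)) ≤ k * (k - 1)) : f * (r * (r - 1)) ≤ n * (n - 1) := by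
  subst hkg hgl
  rcases hV.eq_or_lt with hkr | hkr
  · obtain rfl : k = r - 1 := by linarith
    have hl : l = 0 := by
      by_contra hl
      have : 1 ≤ l := by omega
      nlinarith [mul_le_mul_of_nonneg_right this (show 0 ≤ r * (r - 1) by nlinarith)]
    subst hl
    rcases hn with hn | hn
    · obtain rfl : g = 1 := by linarith
      linarith
    · nlinarith [mul_nonneg (sub_nonneg.mpr hrn) (sub_nonneg.mpr hn)]
  · rcases hn with hn | hn
    · obtain rfl : g = 0 := by linarith
      linarith
    · nlinarith [mul_nonneg hg (show 0 ≤ (k + g) + k - 1 - r * (r - 1) by nlinarith)]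

/-- `G` collects the edges with a private vertex, `W` one such vertex for each. Edges in `L` avoid
`W` and pairwise meet at most once, so their pairs are distinct pairs of `Wᶜ`. -/
lemma IsUnionFree.card_mul_le [Fintype α] {r : ℕ} {F : Finset (Finset α)}
    (h : IsUnionFree r F) (hs : (F : Set (Finset α)).Sized r) (hr : 2 ≤ r)
    (hrn : r ≤ Fintype.card α)
    (hn : Fintype.card α = r ∨ (r - 1) ^ 2 ≤ Fintype.card α) :
    (F.card : ℤ) * (r * (r - 1)) ≤ Fintype.card α * (Fintype.card α - 1) := by
  classical
  set own : Finset α → α → Prop := fun A x => x ∈ A ∧ ∀ B ∈ F, x ∈ B → B = A with hown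
  set G := F.filter fun A => ∃ x, own A x with hG
  set L := F.filter fun A => ¬ ∃ x, own A x with hL
  have hGL : G.card + L.card = F.card := Finset.card_filter_add_card_filter_not _
  have hex : ∀ A ∈ G, ∃ x, own A x := fun A hA => (Finset.mem_filter.mp hA).2
  have : Nonempty α := Fintype.card_pos_iff.mp (by omega)
  choose! f hf using hex
  set W := G.image f with hW
  have hfeq : ∀ A ∈ F, ∀ B ∈ G, f B ∈ A → A = B := fun A hA B hB hx => (hf B hB).2 A hA hx
  have hWcard : W.card = G.card := Finset.card_image_of_injOn fun A hA B hB hAB => by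
    refine hfeq A (Finset.mem_filter.mp hA).1 B hB ?_
    rw [← hAB]; exact (hf A hA).1
  have hVcard : Wᶜ.card + G.card = Fintype.card α := by
    rw [← hWcard, add_comm]; exact Finset.card_add_card_compl W
  have hpairs : L.card * r.choose 2 ≤ Wᶜ.card.choose 2 := by
    refine card_mul_choose_two_le (fun A hA => hs (Finset.mem_filter.mp hA).1) ?_ ?_
    · intro A hA x hx
      rw [Finset.mem_compl]
      intro hxW
      obtain ⟨B, hB, rfl⟩ := Finset.mem_image.mp hxW
      have := hfeq A (Finset.mem_filter.mp hA).1 B hB hx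
      exact (Finset.mem_filter.mp hA).2 (this ▸ (Finset.mem_filter.mp hB).2)
    · intro A hA B hB hAB
      have hA' := Finset.mem_filter.mp hA
      refine h.card_inter_le_one hs hA'.1 (Finset.mem_filter.mp hB).1 hAB fun x hx => ?_
      by_contra! hc
      exact hA'.2 ⟨x, hx, fun C hC hxC => hc C hC hxC⟩
  have hV : r ≤ Wᶜ.card + 1 := by
    rcases G.eq_empty_or_nonempty with h0 | ⟨A, hA⟩
    · rw [h0, Finset.card_empty] at hVcard; omega
    -- The only chosen vertex on `A` is its own, so its other `r - 1` vertices are unchosen.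
    · have hsub : A.erase (f A) ⊆ Wᶜ := by
        intro x hx
        rw [Finset.mem_erase] at hx
        rw [Finset.mem_compl]
        intro hxW
        obtain ⟨B, hB, rfl⟩ := Finset.mem_image.mp hxW
        have := hfeq A (Finset.mem_filter.mp hA).1 B hB hx.2
        exact hx.1 (by rw [this])
      have h1 := Finset.card_le_card hsub
      rw [Finset.card_erase_of_mem (hf A hA).1, hs (Finset.mem_filter.mp hA).1] at h1
      omega
  refine count_bound (k := Wᶜ.card) (g := G.card) (l := L.card) (by exact_mod_cast hr)
    (by exact_mod_cast hrn) ?_ (by exact_mod_cast hV) (by exact_mod_cast hVcard)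
    (by exact_mod_cast hGL) (by positivity) (by positivity) ?_
  · refine hn.imp (fun h => by exact_mod_cast h) fun h => ?_
    have h1 : ((r - 1 : ℕ) : ℤ) = r - 1 := by push_cast [show 1 ≤ r by omega]; rfl
    rw [← h1]
    exact_mod_cast h
  · rw [← two_mul_choose_two_cast, ← two_mul_choose_two_cast, mul_left_comm]
    exact mul_le_mul_of_nonneg_left (by exact_mod_cast hpairs) (by norm_num)

end UpperBound

lemma exists_card_eq_maxUnionFree (r n e : ℕ) : ∃ F : Finset (Finset (Fin n)),
    (F : Set (Finset (Fin n))).Sized r ∧ IsUnionFree e F ∧ maxUnionFree r n e = F.card := by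
  classical
  obtain ⟨F, hF, he⟩ := Finset.exists_mem_eq_sup
    ((Finset.univ : Finset (Finset (Finset (Fin n)))).filter
      fun F : Finset (Finset (Fin n)) =>
        (F : Set (Finset (Fin n))).Sized r ∧ IsUnionFree e F)
    ⟨∅, by
      rw [Finset.mem_filter]
      refine ⟨Finset.mem_univ _, by simp [Set.Sized], ?_⟩
      intro A hA B hB hAB h0
      rw [Finset.subset_empty.mp hA] at h0
      simp at h0⟩ Finset.card
  refine ⟨F, (Finset.mem_filter.mp hF).2.1, (Finset.mem_filter.mp hF).2.2, ?_⟩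
  unfold maxUnionFree
  convert he

lemma card_le_maxUnionFree {r n e : ℕ} {F : Finset (Finset (Fin n))}
    (hs : (F : Set (Finset (Fin n))).Sized r) (h : IsUnionFree e F) :
    F.card ≤ maxUnionFree r n e := by
  classical
  unfold maxUnionFree
  exact Finset.le_sup (f := Finset.card) (Finset.mem_filter.mpr ⟨Finset.mem_univ _, hs, h⟩)

lemma maxUnionFree_le {r n : ℕ} (hr : 2 ≤ r) (hrn : r ≤ n) (hn : n = r ∨ (r - 1) ^ 2 ≤ n) :
    (maxUnionFree r n r : ℝ) ≤ ((n : ℝ) * ((n : ℝ) - 1)) / ((r : ℝ) * ((r : ℝ) - 1)) := by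
  obtain ⟨F, hs, hF, he⟩ := exists_card_eq_maxUnionFree r n r
  have h := hF.card_mul_le hs hr (by simpa using hrn) (by simpa using hn)
  rw [Fintype.card_fin, ← he] at h
  have hr' : (2 : ℝ) ≤ r := by exact_mod_cast hr
  rw [le_div_iff₀ (by nlinarith)]
  exact_mod_cast h

/-! ### Linear families without triangles and grids -/

section Moreover

variable {α : Type*} [DecidableEq α]

/-- If an edge outside `ℬ` is covered by at most `r` edges of `ℬ`, then these are `r` pairwise
disjoint edges, each meeting it. -/
lemma exactly_covered_of_subset_biUnion {r : ℕ} {F : Finset (Finset α)}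
    (hs : (F : Set (Finset α)).Sized r) (hlin : IsLinearFamily F) (htri : ¬ ContainsTriangle F)
    {A : Finset α} (hA : A ∈ F) {ℬ : Finset (Finset α)} (hℬ : ℬ ⊆ F) (hAℬ : A ∉ ℬ)
    (hcard : ℬ.card ≤ r) (hcov : A ⊆ ℬ.biUnion id) :
    ℬ.card = r ∧ (∀ B ∈ ℬ, (A ∩ B).card = 1) ∧
      ∀ B ∈ ℬ, ∀ B' ∈ ℬ, B ≠ B' → Disjoint B B' := by
  have hcA : A.card = r := hs hA
  have hle : ∀ B ∈ ℬ, (A ∩ B).card ≤ 1 := fun B hB =>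
    hlin A hA B (hℬ hB) fun h => hAℬ (h ▸ hB)
  have hAeq : A = ℬ.biUnion fun B => A ∩ B := by
    ext x
    simp only [Finset.mem_biUnion, Finset.mem_inter]
    refine ⟨fun hx => ?_, fun ⟨B, _, hx, _⟩ => hx⟩
    obtain ⟨B, hB, hxB⟩ := Finset.mem_biUnion.mp (hcov hx)
    exact ⟨B, hB, hx, hxB⟩
  have h1 : r ≤ ∑ B ∈ ℬ, (A ∩ B).card := by
    have := Finset.card_biUnion_le (s := ℬ) (t := fun B => A ∩ B)
    rwa [← hAeq, hcA] at this
  have h2 : ∑ B ∈ ℬ, (A ∩ B).card ≤ ∑ B ∈ ℬ, 1 := Finset.sum_le_sum hle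
  have h3 : ∑ B ∈ ℬ, 1 = ℬ.card := by simp
  have hone : ∀ B ∈ ℬ, (A ∩ B).card = 1 :=
    (Finset.sum_eq_sum_iff_of_le hle).mp (by omega)
  refine ⟨by omega, hone, fun B hB B' hB' hne => ?_⟩
  by_contra hdis
  have hne0 : (B ∩ B').Nonempty := Finset.not_disjoint_iff_nonempty_inter.mp hdis
  have hBB' : (B ∩ B').card = 1 :=
    le_antisymm (hlin B (hℬ hB) B' (hℬ hB') hne) hne0.card_pos
  -- If `B` and `B'` hit `A` in the same point, `B` is superfluous and `r - 1` points would cover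
  -- `A`; otherwise `A`, `B`, `B'` form a triangle.
  by_cases hAB : A ∩ B = A ∩ B'
  · have : A = (ℬ.erase B).biUnion fun B => A ∩ B := by
      ext x
      constructor
      · intro hx
        obtain ⟨C, hC, hxC⟩ := Finset.mem_biUnion.mp (hcov hx)
        by_cases hCB : C = B
        · subst hCB
          refine Finset.mem_biUnion.mpr ⟨B', Finset.mem_erase.mpr ⟨hne.symm, hB'⟩, ?_⟩
          rw [← hAB]
          exact Finset.mem_inter.mpr ⟨hx, hxC⟩
        · exact Finset.mem_biUnion.mpr ⟨C, Finset.mem_erase.mpr ⟨hCB, hC⟩,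
            Finset.mem_inter.mpr ⟨hx, hxC⟩⟩
      · intro hx
        obtain ⟨C, _, hxC⟩ := Finset.mem_biUnion.mp hx
        exact (Finset.mem_inter.mp hxC).1
    have h4 := Finset.card_biUnion_le (s := ℬ.erase B) (t := fun B => A ∩ B)
    rw [← this, hcA] at h4
    have h5 : ∑ C ∈ ℬ.erase B, (A ∩ C).card ≤ ∑ C ∈ ℬ.erase B, 1 :=
      Finset.sum_le_sum fun C hC => hle C (Finset.mem_of_mem_erase hC)
    rw [Finset.sum_const, smul_eq_mul, mul_one, Finset.card_erase_of_mem hB] at h5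
    have := Finset.card_pos.mpr ⟨B, hB⟩
    omega
  · refine htri ⟨A, hA, B, hℬ hB, B', hℬ hB', hone B hB, hBB', ?_, hAB⟩
    rw [Finset.inter_comm]
    exact hone B' hB'

lemma biUnion_ne_of_mem_of_notMem {r : ℕ} {F : Finset (Finset α)}
    (hs : (F : Set (Finset α)).Sized r) (hlin : IsLinearFamily F) (htri : ¬ ContainsTriangle F)
    (hgrid : ¬ ContainsGrid r r F) {𝒜 ℬ : Finset (Finset α)} (h𝒜 : 𝒜 ⊆ F) (hℬ : ℬ ⊆ F)
    (hc𝒜 : 𝒜.card ≤ r) (hcℬ : ℬ.card ≤ r) {A : Finset α} (hA : A ∈ 𝒜) (hAℬ : A ∉ ℬ) :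
    𝒜.biUnion id ≠ ℬ.biUnion id := by
  intro heq
  have hcov : ∀ A ∈ 𝒜, A ⊆ ℬ.biUnion id := fun A hA =>
    heq ▸ Finset.subset_biUnion_of_mem id hA
  obtain ⟨hcard, hone, hdis⟩ :=
    exactly_covered_of_subset_biUnion hs hlin htri (h𝒜 hA) hℬ hAℬ hcℬ (hcov A hA)
  -- Otherwise `𝒜` would contain `A` and all `r` members of `ℬ`. With such a `B` the roles of the
  -- two families can be exchanged.
  obtain ⟨B, hB, hB𝒜⟩ : ∃ B ∈ ℬ, B ∉ 𝒜 := by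
    by_contra! hsub
    have := Finset.card_le_card (Finset.insert_subset hA hsub)
    rw [Finset.card_insert_of_notMem hAℬ] at this
    omega
  obtain ⟨hcard', -, hdis'⟩ := exactly_covered_of_subset_biUnion hs hlin htri (hℬ hB) h𝒜 hB𝒜
    hc𝒜 (heq ▸ Finset.subset_biUnion_of_mem id hB)
  have hdisj : ∀ C ∈ 𝒜, C ∉ ℬ := by
    intro C hC hCℬ
    have h1 := hone C hCℬ
    rw [Finset.disjoint_iff_inter_eq_empty.mp
      (hdis' A hA C hC fun h => hAℬ (h ▸ hCℬ)), Finset.card_empty] at h1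
    omega
  exact hgrid ⟨𝒜, h𝒜, ℬ, hℬ, Finset.disjoint_left.mpr hdisj, hcard', hcard, hdis', hdis,
    fun C hC => (exactly_covered_of_subset_biUnion hs hlin htri (h𝒜 hC) hℬ (hdisj C hC) hcℬ
      (hcov C hC)).2.1⟩

theorem isUnionFree_of_linear_of_not_triangle_of_not_grid {r : ℕ} {F : Finset (Finset α)}
    (hs : (F : Set (Finset α)).Sized r) (hlin : IsLinearFamily F) (htri : ¬ ContainsTriangle F)
    (hgrid : ¬ ContainsGrid r r F) : IsUnionFree r F := by
  intro 𝒜 h𝒜 ℬ hℬ hne _ hc𝒜 _ hcℬ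
  by_cases h : 𝒜 ⊆ ℬ
  · obtain ⟨B, hB, hB𝒜⟩ := Finset.not_subset.mp fun h' => hne (h.antisymm h')
    exact (biUnion_ne_of_mem_of_notMem hs hlin htri hgrid hℬ h𝒜 hcℬ hc𝒜 hB hB𝒜).symm
  · obtain ⟨A, hA, hAℬ⟩ := Finset.not_subset.mp h
    exact biUnion_ne_of_mem_of_notMem hs hlin htri hgrid h𝒜 hℬ hc𝒜 hcℬ hA hAℬ

end Moreover

/-! ### Two-coloured line arrangements on the vertical lines `t = i²` -/

section Net

/-- Two colour classes of lines `t ↦ X l + t * d l` whose intersections with the vertical lines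
`t = i²`, `i < r`, form a grid. -/
structure IsLineGrid {ι : Type*} (r : ℕ) (c : ι → Bool) (X d : ι → ℤ) : Prop where
  exists_meet : ∀ l l', c l ≠ c l' → ∃ i < r, X l + (i : ℤ) ^ 2 * d l = X l' + (i : ℤ) ^ 2 * d l'
  meet_unique : ∀ l l', c l ≠ c l' → ∀ i < r, ∀ j < r,
    X l + (i : ℤ) ^ 2 * d l = X l' + (i : ℤ) ^ 2 * d l' →
    X l + (j : ℤ) ^ 2 * d l = X l' + (j : ℤ) ^ 2 * d l' → i = j
  eq_of_meet : ∀ l l', c l = c l' → ∀ i < r,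
    X l + (i : ℤ) ^ 2 * d l = X l' + (i : ℤ) ^ 2 * d l' → l = l'
  exists_partner : ∀ l, ∀ i < r,
    ∃ l', c l ≠ c l' ∧ X l + (i : ℤ) ^ 2 * d l = X l' + (i : ℤ) ^ 2 * d l'

variable {ι : Type*} {r : ℕ} {c : ι → Bool} {X d : ι → ℤ}

/-- `T` and `U` meet over `i²` on the upper envelope, `U` being the steeper one. -/
structure IsTopPair (c : ι → Bool) (X d : ι → ℤ) (i : ℕ) (T U : ι) : Prop where
  color : c T ≠ c U
  meet : X T + (i : ℤ) ^ 2 * d T = X U + (i : ℤ) ^ 2 * d U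
  top : ∀ l, X l + (i : ℤ) ^ 2 * d l ≤ X T + (i : ℤ) ^ 2 * d T
  slope : d T < d U

lemma IsLineGrid.exists_isTopPair_zero [Finite ι] [Nonempty ι] (h : IsLineGrid r c X d)
    (hr : 2 ≤ r) : ∃ T U, IsTopPair c X d 0 T U := by
  obtain ⟨M, hM⟩ := Finite.exists_max fun l => X l + ((0 : ℕ) : ℤ) ^ 2 * d l
  obtain ⟨N, hc, hN⟩ := h.exists_partner M 0 (by omega)
  rcases lt_trichotomy (d M) (d N) with hlt | heq | hlt
  · exact ⟨M, N, hc, hN, hM, hlt⟩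
  · have := h.meet_unique M N hc 0 (by omega) 1 (by omega) hN (by push_cast at *; linarith)
    omega
  · exact ⟨N, M, hc.symm, hN.symm, fun l => hN ▸ hM l, hlt⟩

/-- The upper envelope leaves `i²` along the steeper line and stays on it up to `(i + 1)²`. -/
lemma IsLineGrid.exists_isTopPair_succ [Finite ι] (h : IsLineGrid r c X d)
    {i : ℕ} (hi : i + 1 < r) {T U : ι} (hTU : IsTopPair c X d i T U) :
    ∃ W, IsTopPair c X d (i + 1) U W := by
  have : Nonempty ι := ⟨T⟩
  obtain ⟨hcol, hmeet, htop, hslope⟩ := hTU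
  have hstep : (0 : ℤ) < ((i + 1 : ℕ) : ℤ) ^ 2 - (i : ℤ) ^ 2 := by push_cast; nlinarith
  have hU : ∀ l, X l + ((i + 1 : ℕ) : ℤ) ^ 2 * d l ≤ X U + ((i + 1 : ℕ) : ℤ) ^ 2 * d U := by
    -- Every grid point lies on lines of both colours, so the maximum over `(i + 1)²` is attained in
    -- the colour of `U`.
    obtain ⟨A, hAc, hA⟩ : ∃ A, c A = c U ∧
        ∀ l, X l + ((i + 1 : ℕ) : ℤ) ^ 2 * d l ≤ X A + ((i + 1 : ℕ) : ℤ) ^ 2 * d A := by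
      obtain ⟨M, hM⟩ := Finite.exists_max fun l => X l + ((i + 1 : ℕ) : ℤ) ^ 2 * d l
      by_cases hc : c M = c U
      · exact ⟨M, hc, hM⟩
      · obtain ⟨N, hN, he⟩ := h.exists_partner M (i + 1) hi
        refine ⟨N, ?_, fun l => he ▸ hM l⟩
        revert hc hN
        cases c M <;> cases c N <;> cases c U <;> simp
    by_cases hAU : A = U
    · rwa [hAU] at hA
    -- `A` lies strictly below `T` over `i²` and strictly above it over `(i + 1)²`. Their colours
    -- differ, so they cross over a square, yet none lies strictly between.
    exfalso
    have hAi : X A + (i : ℤ) ^ 2 * d A < X T + (i : ℤ) ^ 2 * d T :=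
      lt_of_le_of_ne (htop A) fun he => hAU (h.eq_of_meet A U hAc i (by omega) (he.trans hmeet))
    obtain ⟨j, hj, he⟩ := h.exists_meet A T (hAc.trans_ne hcol.symm)
    have hA' := hA U
    have hTA : X T + ((i + 1 : ℕ) : ℤ) ^ 2 * d T < X A + ((i + 1 : ℕ) : ℤ) ^ 2 * d A := by
      nlinarith [mul_pos hstep (sub_pos.mpr hslope)]
    have hs : d T < d A := by
      by_contra! hs
      nlinarith [mul_nonneg hstep.le (sub_nonneg.mpr hs)]
    have h1 : (i : ℤ) ^ 2 < (j : ℤ) ^ 2 := by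
      by_contra! hle
      nlinarith [mul_nonneg (sub_nonneg.mpr hle) (sub_pos.mpr hs).le]
    have h2 : (j : ℤ) ^ 2 < ((i + 1 : ℕ) : ℤ) ^ 2 := by
      by_contra! hle
      nlinarith [mul_nonneg (sub_nonneg.mpr hle) (sub_pos.mpr hs).le]
    have h1' : i < j := lt_of_pow_lt_pow_left₀ 2 (by omega) (by exact_mod_cast h1)
    have h2' : j < i + 1 := lt_of_pow_lt_pow_left₀ 2 (by omega) (by exact_mod_cast h2)
    omega
  obtain ⟨W, hW, he⟩ := h.exists_partner U (i + 1) hi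
  refine ⟨W, hW, he, hU, ?_⟩
  have hWi := htop W
  by_contra! hle
  have heq : X U + (i : ℤ) ^ 2 * d U = X W + (i : ℤ) ^ 2 * d W := by
    nlinarith [mul_nonneg hstep.le (sub_nonneg.mpr hle)]
  have := h.meet_unique U W hW i (by omega) (i + 1) hi heq he
  omega

/-- Two lines of different colours that lead at `i²` and at `k²` meet in between. -/
lemma IsLineGrid.exists_meet_between (h : IsLineGrid r c X d) {i k : ℕ} {S T : ι}
    (hc : c S ≠ c T) (hslope : d S < d T)
    (hS : X T + (i : ℤ) ^ 2 * d T ≤ X S + (i : ℤ) ^ 2 * d S)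
    (hT : X S + (k : ℤ) ^ 2 * d S ≤ X T + (k : ℤ) ^ 2 * d T) :
    ∃ j < r, i ≤ j ∧ j ≤ k ∧ X S + (j : ℤ) ^ 2 * d S = X T + (j : ℤ) ^ 2 * d T := by
  obtain ⟨j, hj, he⟩ := h.exists_meet S T hc
  refine ⟨j, hj, ?_, ?_, he⟩
  · refine le_of_pow_le_pow_left₀ two_ne_zero (by omega) ?_
    by_contra! hlt
    have hlt' : (j : ℤ) ^ 2 < (i : ℤ) ^ 2 := by exact_mod_cast hlt
    nlinarith [mul_pos (sub_pos.mpr hlt') (sub_pos.mpr hslope)]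
  · refine le_of_pow_le_pow_left₀ two_ne_zero (by omega) ?_
    by_contra! hlt
    have hlt' : (k : ℤ) ^ 2 < (j : ℤ) ^ 2 := by exact_mod_cast hlt
    nlinarith [mul_pos (sub_pos.mpr hlt') (sub_pos.mpr hslope)]

/-- The lines before and after two consecutive vertices of the upper envelope meet between. -/
lemma IsLineGrid.meet_of_isTopPair (h : IsLineGrid r c X d) {i : ℕ} (hi : i + 2 < r)
    {S T U V : ι} (h₁ : IsTopPair c X d i S T) (h₂ : IsTopPair c X d (i + 1) T U)
    (h₃ : IsTopPair c X d (i + 2) U V) :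
    c S ≠ c V ∧ X S + ((i + 1 : ℕ) : ℤ) ^ 2 * d S = X V + ((i + 1 : ℕ) : ℤ) ^ 2 * d V := by
  have hcSU : c S = c U := by
    have := h₁.color; have := h₂.color; revert this; revert this
    cases c S <;> cases c T <;> cases c U <;> simp
  have hcTV : c T = c V := by
    have := h₂.color; have := h₃.color; revert this; revert this
    cases c V <;> cases c T <;> cases c U <;> simp
  have hcSV : c S ≠ c V := hcSU.trans_ne h₃.color
  refine ⟨hcSV, ?_⟩
  obtain ⟨j, hj, hij, hjk, he⟩ := h.exists_meet_between hcSV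
    (h₁.slope.trans (h₂.slope.trans h₃.slope)) (h₁.top V) (h₃.meet ▸ h₃.top S)
  -- At either end the crossing would put two lines of one colour through a single point.
  obtain rfl | rfl | rfl : j = i ∨ j = i + 1 ∨ j = i + 2 := by omega
  · have := h.eq_of_meet T V hcTV j hj (h₁.meet ▸ he)
    exact absurd (h₂.slope.trans h₃.slope) (by rw [this]; exact lt_irrefl _)
  · exact he
  · have := h.eq_of_meet S U hcSU _ hj (he.trans h₃.meet.symm)
    exact absurd (h₁.slope.trans h₂.slope) (by rw [this]; exact lt_irrefl _)

/-- Let `T₀, T₁, …` be the successive lines of the upper envelope. Besides consecutive crossings,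
`T₀` meets `T₃` over `1` and `T₁` meets `T₄` over `4`. With slope gaps `a, b, c, e > 0` this says `a
= 3c` and `3b = 5e`. One more line, a partner of `T₄` for `r = 4` and `T₅` for `r ≥ 5`, yields an
incompatible relation. -/
theorem IsLineGrid.false [Finite ι] [Nonempty ι] (h : IsLineGrid r c X d) (hr : 4 ≤ r) :
    False := by
  obtain ⟨T₀, T₁, h₀⟩ := h.exists_isTopPair_zero (by omega)
  obtain ⟨T₂, h₁⟩ := h.exists_isTopPair_succ (by omega) h₀
  obtain ⟨T₃, h₂⟩ := h.exists_isTopPair_succ (by omega) h₁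
  obtain ⟨T₄, h₃⟩ := h.exists_isTopPair_succ (by omega) h₂
  obtain ⟨c₀₃, m₀₃⟩ := h.meet_of_isTopPair (by omega) h₀ h₁ h₂
  obtain ⟨c₁₄, m₁₄⟩ := h.meet_of_isTopPair (by omega) h₁ h₂ h₃
  have hne : ∀ {a b : ι}, d a < d b → a ≠ b := fun hab he => by simp [he] at hab
  have hcc : ∀ {a b e : ι}, c a ≠ c b → c b ≠ c e → c a = c e := fun {a b e} => by
    cases c a <;> cases c b <;> cases c e <;> simp
  have s₀ := h₀.slope
  have s₁ := h₁.slope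
  have s₂ := h₂.slope
  have s₃ := h₃.slope
  have m₀ := h₀.meet
  have m₁ := h₁.meet
  have m₂ := h₂.meet
  have m₃ := h₃.meet
  have c₀₂ := hcc h₀.color h₁.color
  have c₁₃ := hcc h₁.color h₂.color
  have c₂₄ := hcc h₂.color h₃.color
  rcases hr.eq_or_lt with rfl | hr5
  -- The envelope is exhausted after `T₄`, so the extra line is the one crossing `T₄` over `0`.
  -- Excluding occupied points puts its crossings with `T₂` and `T₀` over `9` and `4`.
  · obtain ⟨S, cS, mS⟩ := h.exists_partner T₄ 0 (by omega)
    have c₂S : c T₂ ≠ c S := c₂₄.trans_ne cS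
    have c₀S : c T₀ ≠ c S := c₀₂.trans_ne c₂S
    have c₁S : c T₁ = c S := hcc c₁₄ cS
    have c₃S : c T₃ = c S := c₁₃.symm.trans c₁S
    have hS₁ : T₁ ≠ S := by
      rintro rfl
      have := h.meet_unique _ _ cS 0 (by omega) (1 + 1) (by omega) mS m₁₄.symm
      omega
    have hS₃ : T₃ ≠ S := by
      rintro rfl
      have := h.meet_unique _ _ cS 0 (by omega) (0 + 1 + 1 + 1) (by omega) mS m₃.symm
      omega
    have m₂S : X T₂ + ((3 : ℕ) : ℤ) ^ 2 * d T₂ = X S + ((3 : ℕ) : ℤ) ^ 2 * d S := by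
      obtain ⟨j, hj, he⟩ := h.exists_meet T₂ S c₂S
      obtain rfl | rfl | rfl | rfl : j = 0 ∨ j = 1 ∨ j = 2 ∨ j = 3 := by omega
      · exact absurd (h.eq_of_meet T₂ T₄ c₂₄ 0 (by omega) (he.trans mS.symm))
          (hne (s₂.trans s₃))
      · exact absurd (h.eq_of_meet T₁ S c₁S 1 (by omega) (m₁.trans he)) hS₁
      · exact absurd (h.eq_of_meet T₃ S c₃S 2 (by omega) (m₂.symm.trans he)) hS₃
      · exact he
    have m₀S : X T₀ + ((2 : ℕ) : ℤ) ^ 2 * d T₀ = X S + ((2 : ℕ) : ℤ) ^ 2 * d S := by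
      obtain ⟨j, hj, he⟩ := h.exists_meet T₀ S c₀S
      obtain rfl | rfl | rfl | rfl : j = 0 ∨ j = 1 ∨ j = 2 ∨ j = 3 := by omega
      · exact absurd (h.eq_of_meet T₁ S c₁S 0 (by omega) (m₀.symm.trans he)) hS₁
      · exact absurd (h.eq_of_meet T₃ S c₃S 1 (by omega) (m₀₃.symm.trans he)) hS₃
      · exact he
      · exact absurd (h.eq_of_meet T₀ T₂ c₀₂ 3 (by omega) (he.trans m₂S.symm))
          (hne (s₀.trans s₁))
    -- The crossings of `S` give `9a = 5c`, against `a = 3c` with `c > 0`.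
    push_cast at *
    linarith
  · obtain ⟨T₅, h₄⟩ := h.exists_isTopPair_succ (by omega) h₃
    obtain ⟨c₂₅, m₂₅⟩ := h.meet_of_isTopPair (by omega) h₂ h₃ h₄
    have s₄ := h₄.slope
    have m₄ := h₄.meet
    have c₀₅ : c T₀ ≠ c T₅ := c₀₂.trans_ne c₂₅
    have c₁₅ := hcc c₁₄ h₄.color
    have c₃₅ := c₁₃.symm.trans c₁₅
    obtain ⟨j, hj, -, hj4, he⟩ := h.exists_meet_between c₀₅ (by linarith) (h₀.top T₅)
      (h₄.meet ▸ h₄.top T₀)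
    have m₀₅ : X T₀ + ((2 : ℕ) : ℤ) ^ 2 * d T₀ = X T₅ + ((2 : ℕ) : ℤ) ^ 2 * d T₅ := by
      obtain rfl | rfl | rfl | rfl | rfl : j = 0 ∨ j = 1 ∨ j = 2 ∨ j = 3 ∨ j = 4 := by omega
      · exact absurd (h.eq_of_meet T₁ T₅ c₁₅ 0 (by omega) (m₀.symm.trans he))
          (hne (by linarith))
      · exact absurd (h.eq_of_meet T₃ T₅ c₃₅ 1 (by omega) (m₀₃.symm.trans he))
          (hne (by linarith))
      · exact he
      · exact absurd (h.eq_of_meet T₀ T₂ c₀₂ 3 (by omega) (he.trans m₂₅.symm))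
          (hne (by linarith))
      · exact absurd (h.eq_of_meet T₀ T₄ (c₀₂.trans c₂₄) 4 (by omega) (he.trans m₄.symm))
          (hne (by linarith))
    -- With `f` the slope gap from `T₄` to `T₅`, the crossing of `T₂` and `T₅` gives `5c = 7f`, that
    -- of `T₀` and `T₅` gives `a = 3f`, so `c = f`: a contradiction. Equally spaced vertical lines
    -- would give consistent relations here.
    push_cast at *
    linarith

end Net

/-! ### Behrend sets for weighted averages -/

section WeightedBehrend

/-- No element of `D` is a nontrivial weighted average of two others, for positive integer
weights of sum at most `C`. -/
def IsAverageFree (C : ℕ) (D : Finset ℕ) : Prop :=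
  ∀ u ∈ D, ∀ v ∈ D, ∀ w ∈ D, ∀ p q : ℕ, 0 < p → 0 < q → p + q ≤ C →
    p * u + q * v = (p + q) * w → u = v

/-- Strict convexity of the sphere: `pq‖x - y‖² = (p+q)p‖x‖² + (p+q)q‖y‖² - (p+q)²‖z‖²`, which
vanishes for equal norms. -/
lemma eq_of_weighted_average_mem_sphere {n d k p q : ℕ} {x y z : Fin n → ℕ}
    (hx : x ∈ Behrend.sphere n d k) (hy : y ∈ Behrend.sphere n d k)
    (hz : z ∈ Behrend.sphere n d k) (hp : 0 < p) (hq : 0 < q)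
    (h : ∀ i, p * x i + q * y i = (p + q) * z i) : x = y := by
  have hk : ∀ {w : Fin n → ℕ}, w ∈ Behrend.sphere n d k → ∑ i, (w i : ℤ) ^ 2 = k :=
    fun hw => by exact_mod_cast (Finset.mem_filter.mp hw).2
  have hsum : (p : ℤ) * q * ∑ i, ((x i : ℤ) - y i) ^ 2 = 0 := by
    have hi : ∀ i, (p : ℤ) * q * ((x i : ℤ) - y i) ^ 2 =
        (p + q) * p * (x i : ℤ) ^ 2 + (p + q) * q * (y i : ℤ) ^ 2
          - (p + q) ^ 2 * (z i : ℤ) ^ 2 := fun i => by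
      have h' : (p : ℤ) * x i + q * y i = (p + q) * z i := by exact_mod_cast h i
      linear_combination (-(p * x i + q * y i + (p + q) * z i : ℤ)) * h'
    rw [Finset.mul_sum, Finset.sum_congr rfl fun i _ => hi i, Finset.sum_sub_distrib,
      Finset.sum_add_distrib, ← Finset.mul_sum, ← Finset.mul_sum, ← Finset.mul_sum,
      hk hx, hk hy, hk hz]
    ring
  have h0 : ∑ i, ((x i : ℤ) - y i) ^ 2 = 0 := by
    rcases mul_eq_zero.mp hsum with h | h
    · exact absurd h (by positivity)
    · exact h
  rw [Finset.sum_eq_zero_iff_of_nonneg fun i _ => sq_nonneg _] at h0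
  funext i
  have := pow_eq_zero_iff (two_ne_zero) |>.mp (h0 i (Finset.mem_univ i))
  omega

lemma behrend_map_lt_pow {b : ℕ} : ∀ {n : ℕ} {x : Fin n → ℕ}, (∀ i, x i < b) →
    Behrend.map b x < b ^ n
  | 0, x, _ => by simp
  | n + 1, x, hx => by
    have ih : Behrend.map b (x ∘ Fin.succ) < b ^ n := behrend_map_lt_pow fun i => hx _
    rw [Behrend.map_succ', pow_succ]
    have h0 := hx 0
    nlinarith

/-- Points of a most popular sphere in `{0, …, d-1}ⁿ` are read as digits in base `C * d`. Weights of
sum at most `C` cause no carries, so averages of numbers are averages of digit vectors. -/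
lemma exists_isAverageFree_of_digits {C n d : ℕ} (hC : 0 < C) (hn : 0 < n) (hd : 0 < d) :
    ∃ D : Finset ℕ, (∀ u ∈ D, u < (C * d) ^ n) ∧ d ^ n ≤ D.card * (n * d ^ 2) ∧
      IsAverageFree C D := by
  obtain ⟨k, hk⟩ := Behrend.exists_large_sphere n d
  have hlt : ∀ {x}, x ∈ Behrend.sphere n d k → ∀ i, x i < d := fun hx =>
    Behrend.mem_box.mp (Behrend.sphere_subset_box hx)
  have hle : d ≤ C * d := Nat.le_mul_of_pos_left d hC
  refine ⟨(Behrend.sphere n d k).image (Behrend.map (C * d)), ?_, ?_, ?_⟩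
  · intro u hu
    obtain ⟨x, hx, rfl⟩ := Finset.mem_image.mp hu
    exact behrend_map_lt_pow fun i => (hlt hx i).trans_le hle
  · rw [Finset.card_image_of_injOn (Behrend.map_injOn.mono fun x hx i =>
      (hlt hx i).trans_le hle)]
    rw [div_le_iff₀ (by positivity)] at hk
    exact_mod_cast hk
  · intro u hu v hv w hw p q hp hq hpq h
    obtain ⟨x, hx, rfl⟩ := Finset.mem_image.mp hu
    obtain ⟨y, hy, rfl⟩ := Finset.mem_image.mp hv
    obtain ⟨z, hz, rfl⟩ := Finset.mem_image.mp hw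
    have hmap : Behrend.map (C * d) (p • x + q • y) = Behrend.map (C * d) ((p + q) • z) := by
      rw [map_add, map_nsmul, map_nsmul, map_nsmul]
      simpa using h
    have hbound : ∀ e f : ℕ, e < d → f < d → p * e + q * f < C * d := fun e f he hf => by
      have h1 := Nat.mul_lt_mul_of_pos_left he hp
      have h2 := Nat.mul_lt_mul_of_pos_left hf hq
      have h3 := Nat.mul_le_mul_right d hpq
      rw [add_mul] at h3
      omega
    have := Behrend.map_injOn
      (fun i => by simpa using hbound _ _ (hlt hx i) (hlt hy i))
      (fun i => by simpa [add_mul] using hbound _ _ (hlt hz i) (hlt hz i)) hmap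
    rw [eq_of_weighted_average_mem_sphere hx hy hz hp hq fun i => by
      simpa using congrFun this i]

lemma isAverageFree_singleton (C u : ℕ) : IsAverageFree C {u} := by
  intro a ha b hb _ _ _ _ _ _ _ _
  rw [Finset.mem_singleton.mp ha, Finset.mem_singleton.mp hb]

theorem exists_large_isAverageFree (C : ℕ) : ∃ K : ℝ, 0 < K ∧ ∀ m : ℕ, 0 < m →
    ∃ D : Finset ℕ, (∀ u ∈ D, u < m) ∧ IsAverageFree C D ∧
      (m : ℝ) ≤ D.card * Real.exp (K * Real.sqrt (Real.log m)) := by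
  have hC2 : C ≤ 2 ^ C := Nat.lt_two_pow_self.le
  refine ⟨4 * C + 12, by positivity, fun m hm => ?_⟩
  have hm1 : (1 : ℝ) ≤ m := by exact_mod_cast hm
  have hm0 : (0 : ℝ) < m := by linarith
  have hlog0 : 0 ≤ Real.log m := Real.log_nonneg hm1
  have hlog2 : Real.log 2 ≤ 1 := by linarith [Real.log_two_lt_d9]
  have hlog2' : 1 / 4 ≤ Real.log 2 := by linarith [Real.log_two_gt_d9]
  set s := Real.sqrt (Real.log m) with hs
  have hs0 : 0 ≤ s := Real.sqrt_nonneg _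
  have hss : s * s = Real.log m := Real.mul_self_sqrt hlog0
  -- The digit construction with `d = 2 ^ n` and base `2 ^ C * 2 ^ n` needs room `2 ^ ((C + n) *
  -- n)`. The largest such `n` is of order `√(log m)` and costs a factor `2 ^ O(n)`.
  set P : ℕ → Prop := fun n => 2 ^ ((C + n) * n) ≤ m with hP
  set n := Nat.findGreatest P m with hn
  have hPn : P n := Nat.findGreatest_spec (P := P) (Nat.zero_le m) (by simp [hP]; omega)
  have hPn1 : m < 2 ^ ((C + (n + 1)) * (n + 1)) := by
    by_contra! hle
    have hle' : n + 1 ≤ m := by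
      calc n + 1 ≤ 2 ^ (n + 1) := Nat.lt_two_pow_self.le
        _ ≤ 2 ^ ((C + (n + 1)) * (n + 1)) := Nat.pow_le_pow_right (by norm_num) (by nlinarith)
        _ ≤ m := hle
    have : n + 1 ≤ n := Nat.le_findGreatest (P := P) hle' hle
    omega
  rcases Nat.eq_zero_or_pos n with h0 | hpos
  · refine ⟨{0}, by simpa using hm, isAverageFree_singleton C 0, ?_⟩
    rw [Finset.card_singleton, Nat.cast_one, one_mul, ← Real.log_le_iff_le_exp hm0]
    rw [h0] at hPn1
    have h1 : Real.log m ≤ (C + 1) * Real.log 2 := by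
      have : (m : ℝ) ≤ 2 ^ (C + 1) := by exact_mod_cast (by simpa using hPn1.le)
      have := Real.log_le_log hm0 this
      rw [Real.log_pow] at this
      exact_mod_cast this
    have hc0 : (0 : ℝ) ≤ C := by positivity
    have h2 : Real.log m ≤ C + 1 := by nlinarith
    have h3 : s ≤ C + 1 := by nlinarith
    rw [← hss]
    nlinarith
  · have hd : (2 ^ C * 2 ^ n) ^ n = 2 ^ ((C + n) * n) := by rw [← pow_add, ← pow_mul]
    obtain ⟨D, hDlt, hDcard, hD⟩ := exists_isAverageFree_of_digits (C := 2 ^ C) (n := n)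
      (d := 2 ^ n) (by positivity) hpos (by positivity)
    rw [hd] at hDlt
    refine ⟨D, fun u hu => (hDlt u hu).trans_le hPn, fun u hu v hv w hw p q hp hq hpq =>
      hD u hu v hv w hw p q hp hq (hpq.trans hC2), ?_⟩
    have hmD : m ≤ D.card * 2 ^ ((2 * C + 6) * n) := by
      have hn2 : n ≤ 2 ^ n := Nat.lt_two_pow_self.le
      calc m ≤ 2 ^ ((C + (n + 1)) * (n + 1)) := hPn1.le
        _ = 2 ^ (C * n + C + 2 * n + 1) * (2 ^ n) ^ n := by
          rw [← pow_mul, ← pow_add]; congr 1; ring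
        _ ≤ 2 ^ (C * n + C + 2 * n + 1) * (D.card * (2 ^ n * (2 ^ n) ^ 2)) := by
          refine Nat.mul_le_mul_left _ (hDcard.trans ?_)
          gcongr
        _ = D.card * 2 ^ (C * n + C + 5 * n + 1) := by
          rw [← pow_mul, ← pow_add, mul_left_comm, ← pow_add]; congr 2; ring
        _ ≤ D.card * 2 ^ ((2 * C + 6) * n) := by
          refine Nat.mul_le_mul_left _ (Nat.pow_le_pow_right (by norm_num) ?_)
          nlinarith [Nat.mul_le_mul_left C hpos]
    have hns : (n : ℝ) ≤ 2 * s := by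
      have h1 : (2 : ℝ) ^ (n * n) ≤ m := by
        refine le_trans ?_ (by exact_mod_cast hPn : (2 : ℝ) ^ ((C + n) * n) ≤ m)
        exact pow_le_pow_right₀ (by norm_num) (by nlinarith)
      have h2 := Real.log_le_log (by positivity) h1
      rw [Real.log_pow, ← hss] at h2
      push_cast at h2
      have hn0 : (0 : ℝ) ≤ n := by positivity
      nlinarith
    calc (m : ℝ) ≤ D.card * 2 ^ ((2 * C + 6) * n) := by exact_mod_cast hmD
      _ ≤ D.card * Real.exp ((4 * C + 12) * s) := by
        refine mul_le_mul_of_nonneg_left ?_ (by positivity)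
        rw [← Real.log_le_iff_le_exp (by positivity), Real.log_pow]
        push_cast
        have hc0 : (0 : ℝ) ≤ C := by positivity
        have hn0 : (0 : ℝ) ≤ n := by positivity
        calc (2 * (C : ℝ) + 6) * n * Real.log 2 ≤ (2 * (C : ℝ) + 6) * n * 1 := by gcongr
          _ ≤ (2 * (C : ℝ) + 6) * (2 * s) * 1 := by gcongr
          _ = (4 * C + 12) * s := by ring

end WeightedBehrend

/-! ### The construction -/

section Construction

variable {α : Type*} [DecidableEq α] {r m : ℕ} {φ : Fin r × ZMod m → α}

/-- The points of the line `t ↦ x + t * d` over `t = i²`, `i < r`. -/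
def lineEdge (φ : Fin r × ZMod m → α) (x : ZMod m) (d : ℕ) : Finset α :=
  Finset.univ.image fun i : Fin r => φ (i, x + (i : ℕ) ^ 2 * d)

/-- All lines with slope in `D`. -/
def lineFamily [NeZero m] (φ : Fin r × ZMod m → α) (D : Finset ℕ) : Finset (Finset α) :=
  (Finset.univ ×ˢ D).image fun p : ZMod m × ℕ => lineEdge φ p.1 p.2

lemma mem_lineEdge {x : ZMod m} {d : ℕ} {a : α} :
    a ∈ lineEdge φ x d ↔ ∃ i : Fin r, φ (i, x + (i : ℕ) ^ 2 * d) = a := by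
  simp [lineEdge]

lemma apply_mem_lineEdge (hφ : φ.Injective) {x v : ZMod m} {d : ℕ} {i : Fin r} :
    φ (i, v) ∈ lineEdge φ x d ↔ v = x + (i : ℕ) ^ 2 * d := by
  rw [mem_lineEdge]
  constructor
  · rintro ⟨j, hj⟩
    obtain ⟨rfl, rfl⟩ := Prod.ext_iff.mp (hφ hj)
    rfl
  · rintro rfl
    exact ⟨i, rfl⟩

lemma card_lineEdge (hφ : φ.Injective) (x : ZMod m) (d : ℕ) : (lineEdge φ x d).card = r := by
  rw [lineEdge, Finset.card_image_of_injective _ fun i j h => (Prod.ext_iff.mp (hφ h)).1]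
  simp

lemma mem_lineFamily [NeZero m] {D : Finset ℕ} {E : Finset α} :
    E ∈ lineFamily φ D ↔ ∃ x : ZMod m, ∃ d ∈ D, E = lineEdge φ x d := by
  simp only [lineFamily, Finset.mem_image, Finset.mem_product, Finset.mem_univ, true_and,
    Prod.exists]
  exact ⟨fun ⟨x, d, hd, h⟩ => ⟨x, d, hd, h.symm⟩, fun ⟨x, d, hd, h⟩ => ⟨x, d, hd, h.symm⟩⟩

lemma exists_meet_of_mem_inter (hφ : φ.Injective) {x y : ZMod m} {d e : ℕ} {a : α}
    (ha : a ∈ lineEdge φ x d ∩ lineEdge φ y e) :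
    ∃ i : Fin r, a = φ (i, x + (i : ℕ) ^ 2 * d) ∧
      x + ((i : ℕ) : ZMod m) ^ 2 * d = y + ((i : ℕ) : ZMod m) ^ 2 * e := by
  obtain ⟨h1, h2⟩ := Finset.mem_inter.mp ha
  obtain ⟨i, rfl⟩ := mem_lineEdge.mp h1
  exact ⟨i, rfl, (apply_mem_lineEdge hφ).mp h2⟩

lemma mem_inter_of_meet (hφ : φ.Injective) {x y : ZMod m} {d e : ℕ} {i : Fin r}
    (h : x + ((i : ℕ) : ZMod m) ^ 2 * d = y + ((i : ℕ) : ZMod m) ^ 2 * e) :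
    φ (i, x + (i : ℕ) ^ 2 * d) ∈ lineEdge φ x d ∩ lineEdge φ y e :=
  Finset.mem_inter.mpr ⟨(apply_mem_lineEdge hφ).mpr rfl, (apply_mem_lineEdge hφ).mpr h⟩

lemma meet_unique_of_card_inter (hφ : φ.Injective) {x y : ZMod m} {d e : ℕ} {i j : Fin r}
    (hcard : (lineEdge φ x d ∩ lineEdge φ y e).card = 1)
    (hi : x + ((i : ℕ) : ZMod m) ^ 2 * d = y + ((i : ℕ) : ZMod m) ^ 2 * e)
    (hj : x + ((j : ℕ) : ZMod m) ^ 2 * d = y + ((j : ℕ) : ZMod m) ^ 2 * e) : i = j := by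
  obtain ⟨a, ha⟩ := Finset.card_eq_one.mp hcard
  have h1 := mem_inter_of_meet hφ hi
  have h2 := mem_inter_of_meet hφ hj
  rw [ha, Finset.mem_singleton] at h1 h2
  exact (Prod.ext_iff.mp (hφ (h1.trans h2.symm))).1

lemma exists_meet_of_card_inter (hφ : φ.Injective) {x y : ZMod m} {d e : ℕ}
    (hcard : (lineEdge φ x d ∩ lineEdge φ y e).card = 1) :
    ∃ i : Fin r, lineEdge φ x d ∩ lineEdge φ y e = {φ (i, x + (i : ℕ) ^ 2 * d)} ∧
      x + ((i : ℕ) : ZMod m) ^ 2 * d = y + ((i : ℕ) : ZMod m) ^ 2 * e := by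
  obtain ⟨a, ha⟩ := Finset.card_eq_one.mp hcard
  obtain ⟨i, rfl, hi⟩ := exists_meet_of_mem_inter hφ (ha ▸ Finset.mem_singleton_self a)
  exact ⟨i, ha, hi⟩

/-- The factor `4` allows a sum of four such terms to vanish in the integers once it vanishes mod
`m`; the lift of a grid uses all four. -/
lemma abs_sq_mul_sub_lt {i d e : ℕ} (hi : i < r) (hd : 4 * r ^ 2 * d < m)
    (he : 4 * r ^ 2 * e < m) : 4 * |(i : ℤ) ^ 2 * ((d : ℤ) - e)| < m := by
  have h1 : (i : ℤ) ^ 2 ≤ (r : ℤ) ^ 2 := by exact_mod_cast Nat.pow_le_pow_left hi.le 2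
  have hd' : 4 * (r : ℤ) ^ 2 * d < m := by exact_mod_cast hd
  have he' : 4 * (r : ℤ) ^ 2 * e < m := by exact_mod_cast he
  have hi0 : (0 : ℤ) ≤ (i : ℤ) ^ 2 := sq_nonneg _
  have hd0 : (0 : ℤ) ≤ d := by positivity
  have he0 : (0 : ℤ) ≤ e := by positivity
  have h2 : (i : ℤ) ^ 2 * d ≤ (r : ℤ) ^ 2 * d := mul_le_mul_of_nonneg_right h1 hd0
  have h3 : (i : ℤ) ^ 2 * e ≤ (r : ℤ) ^ 2 * e := mul_le_mul_of_nonneg_right h1 he0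
  have h4 := mul_nonneg hi0 hd0
  have h5 := mul_nonneg hi0 he0
  have : |(i : ℤ) ^ 2 * ((d : ℤ) - e)| ≤ max ((i : ℤ) ^ 2 * d) ((i : ℤ) ^ 2 * e) := by
    rw [mul_sub, abs_le]
    constructor
    · linarith [le_max_right ((i : ℤ) ^ 2 * d) ((i : ℤ) ^ 2 * e)]
    · linarith [le_max_left ((i : ℤ) ^ 2 * d) ((i : ℤ) ^ 2 * e)]
  rcases le_max_iff.mp this with h | h <;> linarith

lemma int_eq_zero_of_cast {z : ℤ} (h : (z : ZMod m) = 0) (hz : |z| < m) : z = 0 :=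
  Int.eq_zero_of_abs_lt_dvd ((ZMod.intCast_zmod_eq_zero_iff_dvd z m).mp h) hz

lemma eq_of_meet_twice {x y : ZMod m} {d e i j : ℕ} (hi : i < r) (hj : j < r) (hij : i ≠ j)
    (hd : 4 * r ^ 2 * d < m) (he : 4 * r ^ 2 * e < m)
    (h1 : x + (i : ZMod m) ^ 2 * d = y + (i : ZMod m) ^ 2 * e)
    (h2 : x + (j : ZMod m) ^ 2 * d = y + (j : ZMod m) ^ 2 * e) : x = y ∧ d = e := by
  have hz : (i : ℤ) ^ 2 * ((d : ℤ) - e) - (j : ℤ) ^ 2 * ((d : ℤ) - e) = 0 := by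
    refine int_eq_zero_of_cast (m := m) ?_ ?_
    · push_cast
      linear_combination h1 - h2
    · have := abs_sub ((i : ℤ) ^ 2 * ((d : ℤ) - e)) ((j : ℤ) ^ 2 * ((d : ℤ) - e))
      have h3 := abs_sq_mul_sub_lt hi hd he
      have h4 := abs_sq_mul_sub_lt hj hd he
      linarith [abs_nonneg ((i : ℤ) ^ 2 * ((d : ℤ) - e))]
  have hsq : (i : ℤ) ^ 2 - (j : ℤ) ^ 2 ≠ 0 := by
    intro h
    exact hij (Nat.pow_left_injective two_ne_zero (by exact_mod_cast sub_eq_zero.mp h))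
  rw [← sub_mul] at hz
  have hde : d = e := by
    have := (mul_eq_zero.mp hz).resolve_left hsq
    omega
  subst hde
  exact ⟨add_right_cancel h1, rfl⟩

lemma lineEdge_inj (hφ : φ.Injective) (hr : 2 ≤ r) {x y : ZMod m} {d e : ℕ}
    (hd : 4 * r ^ 2 * d < m) (he : 4 * r ^ 2 * e < m) (h : lineEdge φ x d = lineEdge φ y e) :
    x = y ∧ d = e := by
  have hmeet : ∀ i : Fin r, x + ((i : ℕ) : ZMod m) ^ 2 * d = y + ((i : ℕ) : ZMod m) ^ 2 * e :=
    fun i => (apply_mem_lineEdge hφ).mp (h ▸ (apply_mem_lineEdge hφ).mpr rfl)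
  exact eq_of_meet_twice (r := r) (i := 0) (j := 1) (by omega) (by omega) (by omega) hd he
    (hmeet ⟨0, by omega⟩) (hmeet ⟨1, by omega⟩)

variable [NeZero m] {D : Finset ℕ}

lemma sized_lineFamily (hφ : φ.Injective) :
    (lineFamily φ D : Set (Finset α)).Sized r := by
  intro E hE
  obtain ⟨x, d, -, rfl⟩ := mem_lineFamily.mp hE
  exact card_lineEdge hφ x d

lemma card_lineFamily (hφ : φ.Injective) (hr : 2 ≤ r) (hD : ∀ d ∈ D, 4 * r ^ 2 * d < m) :
    (lineFamily φ D).card = m * D.card := by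
  rw [lineFamily, Finset.card_image_of_injOn]
  · simp [ZMod.card]
  · rintro ⟨x, d⟩ hp ⟨y, e⟩ hq h
    simp only [Finset.coe_product, Set.mem_prod, Finset.mem_coe] at hp hq
    exact Prod.ext_iff.mpr (lineEdge_inj hφ hr (hD d hp.2) (hD e hq.2) h)

lemma isLinearFamily_lineFamily (hφ : φ.Injective) (hD : ∀ d ∈ D, 4 * r ^ 2 * d < m) :
    IsLinearFamily (lineFamily φ D) := by
  intro A hA B hB hne
  obtain ⟨x, d, hd, rfl⟩ := mem_lineFamily.mp hA
  obtain ⟨y, e, he, rfl⟩ := mem_lineFamily.mp hB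
  by_contra! hlt
  obtain ⟨a, ha, b, hb, hab⟩ := Finset.one_lt_card.mp hlt
  obtain ⟨i, rfl, hi⟩ := exists_meet_of_mem_inter hφ ha
  obtain ⟨j, rfl, hj⟩ := exists_meet_of_mem_inter hφ hb
  have hij : i ≠ j := by rintro rfl; exact hab rfl
  obtain ⟨rfl, rfl⟩ := eq_of_meet_twice i.2 j.2 (fun h => hij (Fin.ext h)) (hD d hd) (hD e he)
    hi hj
  exact hne rfl

lemma IsAverageFree.eq_of_sq (hD : IsAverageFree (r ^ 2) D) {a b c : ℕ} (hab : a < b)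
    (hbc : b < c) (hc : c < r) {u v w : ℕ} (hu : u ∈ D) (hv : v ∈ D) (hw : w ∈ D)
    (h : ((b : ℤ) ^ 2 - (a : ℤ) ^ 2) * u + ((c : ℤ) ^ 2 - (b : ℤ) ^ 2) * v =
      ((c : ℤ) ^ 2 - (a : ℤ) ^ 2) * w) : u = v ∧ u = w := by
  have h1 : a ^ 2 < b ^ 2 := Nat.pow_lt_pow_left hab two_ne_zero
  have h2 : b ^ 2 < c ^ 2 := Nat.pow_lt_pow_left hbc two_ne_zero
  have h3 : c ^ 2 < r ^ 2 := Nat.pow_lt_pow_left hc two_ne_zero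
  obtain ⟨p, hp⟩ := Nat.exists_eq_add_of_lt h1
  obtain ⟨q, hq⟩ := Nat.exists_eq_add_of_lt h2
  have hp' : (b : ℤ) ^ 2 = (a : ℤ) ^ 2 + p + 1 := by exact_mod_cast hp
  have hq' : (c : ℤ) ^ 2 = (b : ℤ) ^ 2 + q + 1 := by exact_mod_cast hq
  have huv : u = v := hD u hu v hv w hw (p + 1) (q + 1) (by omega) (by omega) (by omega) (by
    zify
    rw [hq', hp'] at h
    linear_combination h)
  refine ⟨huv, ?_⟩
  subst huv
  have h4 : ((c : ℤ) ^ 2 - (a : ℤ) ^ 2) * ((u : ℤ) - w) = 0 := by linear_combination h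
  have h5 : (c : ℤ) ^ 2 - (a : ℤ) ^ 2 ≠ 0 := by rw [hq', hp']; omega
  have := (mul_eq_zero.mp h4).resolve_left h5
  omega

/-- Collected by slopes, the coefficients are differences of `i², j², k²` with sum zero. Sorting the
indices turns the relation into a weighted average with positive weights of sum below `r²`. -/
lemma IsAverageFree.eq_of_triangle (hD : IsAverageFree (r ^ 2) D) {i j k : ℕ} (hi : i < r)
    (hj : j < r) (hk : k < r) (hij : i ≠ j) (hjk : j ≠ k) (hik : i ≠ k) {u v w : ℕ}
    (hu : u ∈ D) (hv : v ∈ D) (hw : w ∈ D)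
    (h : (i : ℤ) ^ 2 * ((u : ℤ) - v) + (j : ℤ) ^ 2 * ((v : ℤ) - w)
      + (k : ℤ) ^ 2 * ((w : ℤ) - u) = 0) : u = v := by
  rcases lt_or_gt_of_ne hij with h1 | h1 <;> rcases lt_or_gt_of_ne hjk with h2 | h2 <;>
    rcases lt_or_gt_of_ne hik with h3 | h3
  · have := hD.eq_of_sq h1 h2 hk hv hw hu (by linarith)
    omega
  · omega
  · have := hD.eq_of_sq h3 h2 hj hu hw hv (by linarith)
    omega
  · have := hD.eq_of_sq h3 h1 hj hu hv hw (by linarith)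
    omega
  · have := hD.eq_of_sq h1 h3 hk hv hu hw (by linarith)
    omega
  · have := hD.eq_of_sq h2 h3 hi hw hu hv (by linarith)
    omega
  · omega
  · have := hD.eq_of_sq h2 h1 hi hw hv hu (by linarith)
    omega

lemma not_containsTriangle_lineFamily (hφ : φ.Injective) (hr : 2 ≤ r)
    (hD : ∀ d ∈ D, 4 * r ^ 2 * d < m) (hA : IsAverageFree (r ^ 2) D) :
    ¬ ContainsTriangle (lineFamily φ D) := by
  rintro ⟨C₁, h₁, C₂, h₂, C₃, h₃, h₁₂, h₂₃, h₃₁, hne⟩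
  obtain ⟨x, u, hu, rfl⟩ := mem_lineFamily.mp h₁
  obtain ⟨y, v, hv, rfl⟩ := mem_lineFamily.mp h₂
  obtain ⟨z, w, hw, rfl⟩ := mem_lineFamily.mp h₃
  obtain ⟨i, hi, ei⟩ := exists_meet_of_card_inter hφ h₁₂
  obtain ⟨j, -, ej⟩ := exists_meet_of_card_inter hφ h₂₃
  obtain ⟨k, hk, ek⟩ := exists_meet_of_card_inter hφ h₃₁
  have hik : i ≠ k := by
    rintro rfl
    rw [Finset.inter_comm, ek] at hk
    exact hne (hi.trans hk.symm)
  have hij : i ≠ j := by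
    rintro rfl
    exact hik (meet_unique_of_card_inter hφ h₃₁ (ej.symm.trans ei.symm) ek)
  have hjk : j ≠ k := by
    rintro rfl
    exact hij (meet_unique_of_card_inter hφ h₁₂ ei (ek.symm.trans ej.symm))
  have hz : ((i : ℕ) : ℤ) ^ 2 * ((u : ℤ) - v) + ((j : ℕ) : ℤ) ^ 2 * ((v : ℤ) - w)
      + ((k : ℕ) : ℤ) ^ 2 * ((w : ℤ) - u) = 0 := by
    refine int_eq_zero_of_cast (m := m) ?_ ?_
    · push_cast
      linear_combination ei + ej + ek
    · have h1 := abs_sq_mul_sub_lt i.2 (hD u hu) (hD v hv)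
      have h2 := abs_sq_mul_sub_lt j.2 (hD v hv) (hD w hw)
      have h3 := abs_sq_mul_sub_lt k.2 (hD w hw) (hD u hu)
      have h4 := abs_add_three (((i : ℕ) : ℤ) ^ 2 * ((u : ℤ) - v))
        (((j : ℕ) : ℤ) ^ 2 * ((v : ℤ) - w)) (((k : ℕ) : ℤ) ^ 2 * ((w : ℤ) - u))
      linarith [abs_nonneg (((i : ℕ) : ℤ) ^ 2 * ((u : ℤ) - v))]
  have huv : u = v := hA.eq_of_triangle i.2 j.2 k.2 (fun h => hij (Fin.ext h))
    (fun h => hjk (Fin.ext h)) (fun h => hik (Fin.ext h)) hu hv hw hz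
  subst huv
  have hxy : x = y := add_right_cancel ei
  subst hxy
  rw [Finset.inter_self, card_lineEdge hφ] at h₁₂
  omega

/-- The grid is lifted from `ZMod m` to integer lines and refuted by `IsLineGrid.false`. Only
crossings of different colours must be lifted; coincidences within a colour are needed only in the
direction from integers to residues. -/
lemma not_containsGrid_lineFamily (hφ : φ.Injective) (hr : 4 ≤ r)
    (hD : ∀ d ∈ D, 4 * r ^ 2 * d < m) : ¬ ContainsGrid r r (lineFamily φ D) := by
  rintro ⟨𝒜, h𝒜, ℬ, hℬ, -, hc𝒜, hcℬ, hd𝒜, hdℬ, hone⟩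
  choose! x d hd hE using fun (E : Finset α) (hE : E ∈ lineFamily φ D) => mem_lineFamily.mp hE
  have hsmall : ∀ E ∈ lineFamily φ D, 4 * r ^ 2 * d E < m := fun E hE => hD _ (hd E hE)
  -- Meeting in `ZMod m` is the same as sharing a vertex.
  have hexists : ∀ A ∈ 𝒜, ∀ B ∈ ℬ, ∃ i : Fin r,
      x A + ((i : ℕ) : ZMod m) ^ 2 * d A = x B + ((i : ℕ) : ZMod m) ^ 2 * d B := by
    intro A hA B hB
    have h1 := hone A hA B hB
    rw [hE A (h𝒜 hA), hE B (hℬ hB)] at h1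
    obtain ⟨i, -, hi⟩ := exists_meet_of_card_inter hφ h1
    exact ⟨i, hi⟩
  have hunique : ∀ A ∈ 𝒜, ∀ B ∈ ℬ, ∀ i j : Fin r,
      x A + ((i : ℕ) : ZMod m) ^ 2 * d A = x B + ((i : ℕ) : ZMod m) ^ 2 * d B →
      x A + ((j : ℕ) : ZMod m) ^ 2 * d A = x B + ((j : ℕ) : ZMod m) ^ 2 * d B → i = j := by
    intro A hA B hB i j hi hj
    have h1 := hone A hA B hB
    rw [hE A (h𝒜 hA), hE B (hℬ hB)] at h1
    exact meet_unique_of_card_inter hφ h1 hi hj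
  have hsame : ∀ 𝒢 ⊆ lineFamily φ D, (∀ A ∈ 𝒢, ∀ A' ∈ 𝒢, A ≠ A' → Disjoint A A') →
      ∀ A ∈ 𝒢, ∀ B ∈ 𝒢, ∀ i : Fin r,
      x A + ((i : ℕ) : ZMod m) ^ 2 * d A = x B + ((i : ℕ) : ZMod m) ^ 2 * d B → A = B := by
    intro 𝒢 h𝒢 hdis A hA B hB i hi
    by_contra hne
    have h1 := Finset.disjoint_iff_inter_eq_empty.mp (hdis A hA B hB hne)
    have h2 := mem_inter_of_meet hφ hi
    rw [← hE A (h𝒢 hA), ← hE B (h𝒢 hB), h1] at h2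
    exact absurd h2 (Finset.notMem_empty _)
  have : NeZero r := ⟨by omega⟩
  choose! pos hpos using hexists
  obtain ⟨A₀, hA₀⟩ : 𝒜.Nonempty := Finset.card_pos.mp (by omega)
  obtain ⟨B₀, hB₀⟩ : ℬ.Nonempty := Finset.card_pos.mp (by omega)
  -- Integer lifts of the intercepts, relative to `A₀`.
  set Y : Finset α → ℤ := fun B => ((pos A₀ B : ℕ) : ℤ) ^ 2 * ((d A₀ : ℤ) - d B) with hY
  set X : Finset α → ℤ := fun A => Y B₀ + ((pos A B₀ : ℕ) : ℤ) ^ 2 * ((d B₀ : ℤ) - d A) with hX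
  have hYc : ∀ B ∈ ℬ, (Y B : ZMod m) = x B - x A₀ := fun B hB => by
    simp only [hY]; push_cast; linear_combination hpos A₀ hA₀ B hB
  have hXc : ∀ A ∈ 𝒜, (X A : ZMod m) = x A - x A₀ := fun A hA => by
    simp only [hX, Int.cast_add, hYc B₀ hB₀]; push_cast; linear_combination -hpos A hA B₀ hB₀
  have hcast : ∀ A ∈ 𝒜, ∀ B ∈ ℬ, ∀ i : ℕ,
      X A + (i : ℤ) ^ 2 * d A = Y B + (i : ℤ) ^ 2 * d B →
      x A + (i : ZMod m) ^ 2 * d A = x B + (i : ZMod m) ^ 2 * d B := by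
    intro A hA B hB i h
    have h' := congrArg (Int.cast : ℤ → ZMod m) h
    push_cast [hXc A hA, hYc B hB] at h'
    linear_combination h'
  have hlift : ∀ A ∈ 𝒜, ∀ B ∈ ℬ, ∀ i : Fin r,
      x A + ((i : ℕ) : ZMod m) ^ 2 * d A = x B + ((i : ℕ) : ZMod m) ^ 2 * d B →
      X A + ((i : ℕ) : ℤ) ^ 2 * d A = Y B + ((i : ℕ) : ℤ) ^ 2 * d B := by
    intro A hA B hB i h
    -- The lifts follow the path `A₀, B₀, A` and the path `A₀, B`; closing the cycle `A₀, B₀, A, B`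
    -- leaves four terms, each below `m / 4`.
    have hz : X A - Y B + ((i : ℕ) : ℤ) ^ 2 * ((d A : ℤ) - d B) = 0 := by
      refine int_eq_zero_of_cast (m := m) ?_ ?_
      · push_cast [hXc A hA, hYc B hB]
        linear_combination h
      · have h1 := abs_sq_mul_sub_lt (pos A₀ B₀).2 (hsmall A₀ (h𝒜 hA₀)) (hsmall B₀ (hℬ hB₀))
        have h2 := abs_sq_mul_sub_lt (pos A B₀).2 (hsmall B₀ (hℬ hB₀)) (hsmall A (h𝒜 hA))
        have h3 := abs_sq_mul_sub_lt (pos A₀ B).2 (hsmall A₀ (h𝒜 hA₀)) (hsmall B (hℬ hB))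
        have h4 := abs_sq_mul_sub_lt i.2 (hsmall A (h𝒜 hA)) (hsmall B (hℬ hB))
        simp only [hX, hY]
        rw [← mul_lt_mul_iff_right₀ (show (0 : ℤ) < 4 by norm_num)]
        have h5 := abs_add_le (((pos A₀ B₀ : ℕ) : ℤ) ^ 2 * ((d A₀ : ℤ) - d B₀) +
          ((pos A B₀ : ℕ) : ℤ) ^ 2 * ((d B₀ : ℤ) - d A) -
          ((pos A₀ B : ℕ) : ℤ) ^ 2 * ((d A₀ : ℤ) - d B)) (((i : ℕ) : ℤ) ^ 2 * ((d A : ℤ) - d B))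
        have h6 := abs_sub (((pos A₀ B₀ : ℕ) : ℤ) ^ 2 * ((d A₀ : ℤ) - d B₀) +
          ((pos A B₀ : ℕ) : ℤ) ^ 2 * ((d B₀ : ℤ) - d A))
          (((pos A₀ B : ℕ) : ℤ) ^ 2 * ((d A₀ : ℤ) - d B))
        have h7 := abs_add_le (((pos A₀ B₀ : ℕ) : ℤ) ^ 2 * ((d A₀ : ℤ) - d B₀))
          (((pos A B₀ : ℕ) : ℤ) ^ 2 * ((d B₀ : ℤ) - d A))
        linarith
    linear_combination hz
  have hcast𝒜 : ∀ A ∈ 𝒜, ∀ A' ∈ 𝒜, ∀ i : ℕ,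
      X A + (i : ℤ) ^ 2 * d A = X A' + (i : ℤ) ^ 2 * d A' →
      x A + (i : ZMod m) ^ 2 * d A = x A' + (i : ZMod m) ^ 2 * d A' := by
    intro A hA A' hA' i h
    have h' := congrArg (Int.cast : ℤ → ZMod m) h
    push_cast [hXc A hA, hXc A' hA'] at h'
    linear_combination h'
  have hcastℬ : ∀ B ∈ ℬ, ∀ B' ∈ ℬ, ∀ i : ℕ,
      Y B + (i : ℤ) ^ 2 * d B = Y B' + (i : ℤ) ^ 2 * d B' →
      x B + (i : ZMod m) ^ 2 * d B = x B' + (i : ZMod m) ^ 2 * d B' := by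
    intro B hB B' hB' i h
    have h' := congrArg (Int.cast : ℤ → ZMod m) h
    push_cast [hYc B hB, hYc B' hB'] at h'
    linear_combination h'
  have hpartner𝒜 : ∀ A ∈ 𝒜, ∀ i : Fin r, ∃ B ∈ ℬ, pos A B = i := by
    intro A hA i
    -- The `r` disjoint edges of `ℬ` meet `A` in distinct points, hence at each of its `r` positions
    -- once.
    have hinj : Function.Injective fun B : ℬ => pos A B := fun B B' h => by
      refine Subtype.ext (hsame ℬ hℬ hdℬ B B.2 B' B'.2 (pos A B) ?_)
      have h1 := hpos A hA B B.2
      have h2 := hpos A hA B' B'.2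
      rw [show pos A B' = pos A B from h.symm] at h2
      exact h1.symm.trans h2
    obtain ⟨B, hB⟩ := ((Fintype.bijective_iff_injective_and_card _).mpr
      ⟨hinj, by simp [hcℬ]⟩).2 i
    exact ⟨B, B.2, hB⟩
  have hpartnerℬ : ∀ B ∈ ℬ, ∀ i : Fin r, ∃ A ∈ 𝒜, pos A B = i := by
    intro B hB i
    have hinj : Function.Injective fun A : 𝒜 => pos A B := fun A A' h => by
      refine Subtype.ext (hsame 𝒜 h𝒜 hd𝒜 A A.2 A' A'.2 (pos A B) ?_)
      have h1 := hpos A A.2 B hB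
      have h2 := hpos A' A'.2 B hB
      rw [show pos A' B = pos A B from h.symm] at h2
      exact h1.trans h2.symm
    obtain ⟨A, hA⟩ := ((Fintype.bijective_iff_injective_and_card _).mpr
      ⟨hinj, by simp [hc𝒜]⟩).2 i
    exact ⟨A, A.2, hA⟩
  have hgrid : IsLineGrid (ι := 𝒜 ⊕ ℬ) r Sum.isLeft (Sum.elim (fun A => X A) (fun B => Y B))
      (Sum.elim (fun A => (d A : ℤ)) (fun B => (d B : ℤ))) := by
    constructor
    · rintro (A | B) (A' | B') hc <;> simp only [Sum.isLeft, ne_eq, not_true_eq_false] at hc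
      · exact ⟨pos A B', (pos A B').2, hlift A A.2 B' B'.2 _ (hpos A A.2 B' B'.2)⟩
      · exact ⟨pos A' B, (pos A' B).2, (hlift A' A'.2 B B.2 _ (hpos A' A'.2 B B.2)).symm⟩
    · rintro (A | B) (A' | B') hc i hi j hj h1 h2 <;>
        simp only [Sum.isLeft, ne_eq, not_true_eq_false] at hc
      · exact congrArg Fin.val (hunique A A.2 B' B'.2 ⟨i, hi⟩ ⟨j, hj⟩
          (hcast A A.2 B' B'.2 i h1) (hcast A A.2 B' B'.2 j h2))
      · exact congrArg Fin.val (hunique A' A'.2 B B.2 ⟨i, hi⟩ ⟨j, hj⟩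
          (hcast A' A'.2 B B.2 i h1.symm) (hcast A' A'.2 B B.2 j h2.symm))
    · rintro (A | B) (A' | B') hc i hi h <;> simp [Sum.isLeft] at hc
      · exact congrArg Sum.inl (Subtype.ext (hsame 𝒜 h𝒜 hd𝒜 A A.2 A' A'.2 ⟨i, hi⟩
          (hcast𝒜 A A.2 A' A'.2 i h)))
      · exact congrArg Sum.inr (Subtype.ext (hsame ℬ hℬ hdℬ B B.2 B' B'.2 ⟨i, hi⟩
          (hcastℬ B B.2 B' B'.2 i h)))
    · rintro (A | B) i hi
      · obtain ⟨B, hB, hp⟩ := hpartner𝒜 A A.2 ⟨i, hi⟩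
        have h := hlift A A.2 B hB _ (hpos A A.2 B hB)
        rw [hp] at h
        exact ⟨Sum.inr ⟨B, hB⟩, by simp, h⟩
      · obtain ⟨A, hA, hp⟩ := hpartnerℬ B B.2 ⟨i, hi⟩
        have h := hlift A hA B B.2 _ (hpos A hA B B.2)
        rw [hp] at h
        exact ⟨Sum.inl ⟨A, hA⟩, by simp, h.symm⟩
  have : Nonempty (𝒜 ⊕ ℬ) := ⟨Sum.inl ⟨A₀, hA₀⟩⟩
  exact hgrid.false hr

lemma isPerfectMatchingFamily_lineEdge (hφ : φ.Bijective) (d : ℕ) :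
    IsPerfectMatchingFamily (Finset.univ.image fun x : ZMod m => lineEdge φ x d) := by
  intro a
  obtain ⟨⟨i, v⟩, rfl⟩ := hφ.2 a
  refine ⟨lineEdge φ (v - ((i : ℕ) : ZMod m) ^ 2 * d) d, ⟨by simp, ?_⟩, ?_⟩
  · rw [apply_mem_lineEdge hφ.1]; ring
  · rintro E ⟨hE, ha⟩
    obtain ⟨x, -, rfl⟩ := Finset.mem_image.mp hE
    rw [apply_mem_lineEdge hφ.1] at ha
    rw [ha, add_sub_cancel_right]

lemma decomposesIntoPerfectMatchings_lineFamily (hφ : φ.Bijective) (hr : 2 ≤ r)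
    (hD : ∀ d ∈ D, 4 * r ^ 2 * d < m) : DecomposesIntoPerfectMatchings (lineFamily φ D) := by
  refine ⟨D.image fun d => Finset.univ.image fun x : ZMod m => lineEdge φ x d, ?_, ?_, ?_⟩
  · intro M hM
    obtain ⟨d, -, rfl⟩ := Finset.mem_image.mp hM
    exact isPerfectMatchingFamily_lineEdge hφ d
  · intro M hM M' hM' hne
    obtain ⟨d, hd, rfl⟩ := Finset.mem_image.mp hM
    obtain ⟨e, he, rfl⟩ := Finset.mem_image.mp hM'
    refine Finset.disjoint_left.mpr fun E hE hE' => hne ?_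
    obtain ⟨x, -, rfl⟩ := Finset.mem_image.mp hE
    obtain ⟨y, -, h⟩ := Finset.mem_image.mp hE'
    rw [(lineEdge_inj hφ.1 hr (hD e he) (hD d hd) h).2]
  · ext E
    rw [mem_lineFamily]
    simp only [Finset.mem_biUnion, Finset.mem_image, id]
    constructor
    · rintro ⟨_, ⟨d, hd, rfl⟩, hE⟩
      obtain ⟨x, -, rfl⟩ := Finset.mem_image.mp hE
      exact ⟨x, d, hd, rfl⟩
    · rintro ⟨x, d, hd, rfl⟩
      exact ⟨_, ⟨d, hd, rfl⟩, Finset.mem_image_of_mem _ (Finset.mem_univ x)⟩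

end Construction

/-! ### Regularity and the choice of parameters -/

lemma DecomposesIntoPerfectMatchings.isRegularFamily {α : Type*} [DecidableEq α]
    {F : Finset (Finset α)}
    (h : DecomposesIntoPerfectMatchings F) : IsRegularFamily F := by
  obtain ⟨P, hP, hdis, rfl⟩ := h
  refine ⟨P.card, fun x => ?_⟩
  rw [Finset.filter_biUnion, Finset.card_biUnion]
  · rw [Finset.sum_congr rfl fun M hM => ?_, Finset.sum_const, smul_eq_mul, mul_one]
    obtain ⟨A, hA, huniq⟩ := hP M hM x
    rw [Finset.card_eq_one]
    refine ⟨A, ?_⟩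
    ext B
    simp only [id, Finset.mem_filter, Finset.mem_singleton]
    exact ⟨fun hB => huniq B hB, fun hB => hB ▸ hA⟩
  · exact fun M hM M' hM' hne => Finset.disjoint_filter_filter (hdis M hM M' hM' hne)

theorem exists_large_isUnionFree (r : ℕ) (hr : 4 ≤ r) : ∃ β : ℝ, 0 < β ∧ ∀ n : ℕ, r ≤ n →
    ∃ F : Finset (Finset (Fin n)), (F : Set (Finset (Fin n))).Sized r ∧ IsUnionFree r F ∧
      (n : ℝ) ^ 2 * Real.exp (-β * Real.sqrt (Real.log n)) < (F.card : ℝ) ∧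
      (r ∣ n → DecomposesIntoPerfectMatchings F) := by
  obtain ⟨K, hK, hbehrend⟩ := exists_large_isAverageFree (r ^ 2)
  set Q : ℕ := 4 * r ^ 2 + 1 with hQ
  set L : ℝ := Real.log (4 * r ^ 2 * Q) with hL
  have hr' : (4 : ℝ) ≤ r := by exact_mod_cast hr
  have hQ1 : (1 : ℝ) ≤ Q := by rw [hQ]; push_cast; nlinarith
  have hL0 : 0 ≤ L := Real.log_nonneg (by nlinarith)
  -- `K` pays for the Behrend set, `L` for the constant `4 r² Q` lost in rounding and scaling, and
  -- the extra `1` makes the inequality strict.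
  refine ⟨K + L + 1, by positivity, fun n hn => ?_⟩
  set m := n / r with hm
  have hmpos : 0 < m := Nat.div_pos hn (by omega)
  have : NeZero m := ⟨hmpos.ne'⟩
  have hmn : r * m ≤ n := Nat.mul_div_le n r
  obtain ⟨φ⟩ : Nonempty (Fin r × ZMod m ↪ Fin n) :=
    Function.Embedding.nonempty_of_card_le (by simpa [ZMod.card] using hmn)
  -- Slopes are at most `m / Q`, so `4 r² d < m` as `Q` exceeds `4 r²`; the `+ 1` keeps the range
  -- nonempty when `m < Q`.
  obtain ⟨D, hDlt, hDavg, hDcard⟩ := hbehrend (m / Q + 1) (Nat.succ_pos _)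
  have hD : ∀ d ∈ D, 4 * r ^ 2 * d < m := by
    intro d hd
    have h1 : d ≤ m / Q := Nat.lt_succ_iff.mp (hDlt d hd)
    have h2 : d * Q ≤ m := (Nat.le_div_iff_mul_le (by omega)).mp h1
    rw [hQ] at h2
    rcases Nat.eq_zero_or_pos d with rfl | hd0
    · simpa using hmpos
    · nlinarith
  have hs := sized_lineFamily (D := D) φ.injective
  refine ⟨lineFamily φ D, hs, isUnionFree_of_linear_of_not_triangle_of_not_grid hs
    (isLinearFamily_lineFamily φ.injective hD)
    (not_containsTriangle_lineFamily φ.injective (by omega) hD hDavg)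
    (not_containsGrid_lineFamily φ.injective hr hD), ?_, fun hdvd => ?_⟩
  · rw [card_lineFamily φ.injective (by omega) hD]
    set s := Real.sqrt (Real.log n) with hsdef
    have hn4 : (4 : ℝ) ≤ n := by exact_mod_cast hr.trans hn
    have hn0 : (0 : ℝ) < n := by linarith
    -- Since `n ≥ 4 > e`; this lets the constant `L` be absorbed into `L * s`.
    have hs1 : 1 ≤ s := by
      rw [hsdef, Real.one_le_sqrt, Real.le_log_iff_exp_le hn0]
      linarith [Real.exp_one_lt_d9]
    have hmn' : (n : ℝ) ≤ 2 * r * m := by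
      have h1 : n < r * (m + 1) := Nat.lt_mul_div_succ n (by omega)
      have h2 : n ≤ 2 * r * m := by nlinarith
      exact_mod_cast h2
    have hM : (m : ℝ) ≤ Q * ((m / Q + 1 : ℕ) : ℝ) := by
      have h1 : m < Q * (m / Q + 1) := Nat.lt_mul_div_succ m (by omega)
      exact_mod_cast h1.le
    have hMn : ((m / Q + 1 : ℕ) : ℝ) ≤ n := by
      have h1 : m / Q ≤ m := Nat.div_le_self m Q
      have h2 : m / Q + 1 ≤ n := by nlinarith
      exact_mod_cast h2
    have hDcard' : ((m / Q + 1 : ℕ) : ℝ) ≤ D.card * Real.exp (K * s) := by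
      refine hDcard.trans (mul_le_mul_of_nonneg_left (Real.exp_le_exp.mpr ?_) (by positivity))
      refine mul_le_mul_of_nonneg_left (Real.sqrt_le_sqrt ?_) hK.le
      exact Real.log_le_log (by positivity) hMn
    have hbound : (n : ℝ) ^ 2 ≤ (4 * r ^ 2 * Q) * ((m * D.card : ℝ) * Real.exp (K * s)) := by
      calc (n : ℝ) ^ 2 ≤ (2 * r * m : ℝ) ^ 2 := by gcongr
        _ = (4 * r ^ 2 * m * m : ℝ) := by ring
        _ ≤ (4 * r ^ 2 * m * (Q * (D.card * Real.exp (K * s))) : ℝ) := by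
          gcongr
          exact hM.trans (by gcongr)
        _ = _ := by ring
    have hDpos : (0 : ℝ) < m * D.card := by
      by_contra! hle
      have h1 : (4 * r ^ 2 * Q) * ((m * D.card : ℝ) * Real.exp (K * s)) ≤ 0 :=
        mul_nonpos_of_nonneg_of_nonpos (by positivity)
          (mul_nonpos_of_nonpos_of_nonneg hle (Real.exp_pos _).le)
      nlinarith
    have hQexp : (4 * r ^ 2 * Q : ℝ) = Real.exp L := (Real.exp_log (by positivity)).symm
    push_cast
    calc (n : ℝ) ^ 2 * Real.exp (-(K + L + 1) * s)
        ≤ (Real.exp L * ((m * D.card : ℝ) * Real.exp (K * s))) *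
          Real.exp (-(K + L + 1) * s) := by
          rw [← hQexp]
          exact mul_le_mul_of_nonneg_right hbound (Real.exp_pos _).le
      _ = (m * D.card : ℝ) * Real.exp (L + K * s + -(K + L + 1) * s) := by
          rw [Real.exp_add, Real.exp_add]; ring
      _ < (m * D.card : ℝ) * 1 := by
          refine mul_lt_mul_of_pos_left ?_ hDpos
          rw [Real.exp_lt_one_iff]
          nlinarith
      _ = m * D.card := mul_one _
  · have hcard : Fintype.card (Fin r × ZMod m) = Fintype.card (Fin n) := by
      simpa [ZMod.card] using Nat.mul_div_cancel' hdvd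
    exact decomposesIntoPerfectMatchings_lineFamily
      ((Fintype.bijective_iff_injective_and_card φ).mpr ⟨φ.injective, hcard⟩) (by omega) hD

theorem corollary15 (r : ℕ) (hr : 4 ≤ r) :
    (∃ β : ℝ, 0 < β ∧ ∀ n : ℕ, r ≤ n →
      (n : ℝ) ^ 2 * Real.exp (-β * Real.sqrt (Real.log n)) < (maxUnionFree r n r : ℝ) ∧
      (n = r ∨ (r - 1) ^ 2 ≤ n →
        (maxUnionFree r n r : ℝ) ≤ ((n : ℝ) * ((n : ℝ) - 1)) / ((r : ℝ) * ((r : ℝ) - 1))) ∧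
      (r ∣ n → ∃ F : Finset (Finset (Fin n)),
        (F : Set (Finset (Fin n))).Sized r ∧ IsUnionFree r F ∧
        (n : ℝ) ^ 2 * Real.exp (-β * Real.sqrt (Real.log n)) < (F.card : ℝ) ∧
        DecomposesIntoPerfectMatchings F ∧ IsRegularFamily F)) ∧
    (∀ (n : ℕ) (F : Finset (Finset (Fin n))),
      (F : Set (Finset (Fin n))).Sized r → IsLinearFamily F →
      ¬ ContainsTriangle F → ¬ ContainsGrid r r F → IsUnionFree r F) := by
  obtain ⟨β, hβ, h⟩ := exists_large_isUnionFree r hr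
  refine ⟨⟨β, hβ, fun n hn => ?_⟩, fun n F hs hlin htri hgrid =>
    isUnionFree_of_linear_of_not_triangle_of_not_grid hs hlin htri hgrid⟩
  obtain ⟨F, hs, hF, hcard, hdec⟩ := h n hn
  exact ⟨hcard.trans_le (by exact_mod_cast card_le_maxUnionFree hs hF),
    maxUnionFree_le (by omega) hn,
    fun hdvd => ⟨F, hs, hF, hcard, hdec hdvd, (hdec hdvd).isRegularFamily⟩⟩
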